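/- Corollary (monotonicity of the Belavkin–Staszewski relative entropy). Consider an $n$-level quantum system, and let $\{\mathcal{E}^\dagger_t\}_{t\ge 0}$, $t\in\mathbb{N}$, be a sequence of TPCP maps, i.e. linear, completely positive, trace-preserving maps from the complex $n\times n$ matrices to themselves. Let $\rho_0,\sigma_0$ be density matrices (positive semidefinite, of unit trace) and let $\rho_{t+1}=\mathcal{E}^\dagger_t(\rho_t)$, $\sigma_{t+1}=\mathcal{E}^\dagger_t(\sigma_t)$ for all $t\ge 0$ be the two quantum Markov evolutions that they generate. Assume that $\rho_t$ and $\sigma_t$ are invertible for all $t\ge 0$. For invertible density matrices $\rho,\sigma$ put $$\mathbb{D}_{BS}(\rho\|\sigma)=\mathrm{trace}\big(\sigma\, Y\log Y\big),\qquad Y=\sigma^{-1/2}\rho\,\sigma^{-1/2},$$ which is a real number. Then for all $t\ge 0$, $$\mathbb{D}_{BS}(\rho_{t+1}\|\sigma_{t+1})\le \mathbb{D}_{BS}(\rho_t\|\sigma_t).$$ -/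

import Mathlib

open scoped ComplexOrder MatrixOrder Matrix.Norms.L2Operator CStarAlgebra

/-- A density matrix: a positive semidefinite complex matrix of unit trace. -/
structure IsDensityMatrix {n : Type*} [Fintype n] (ρ : Matrix n n ℂ) : Prop where
  posSemidef : ρ.PosSemidef
  trace_eq_one : ρ.trace = 1

/-- A TPCP map on `n × n` complex matrices: a completely positive linear map (Mathlib's notion, for
the C⋆-algebra of matrices with the operator norm and the Loewner order) preserving the trace. -/
structure TPCPMap (n : Type*) [Fintype n] [DecidableEq n] extends
    CompletelyPositiveMap (Matrix n n ℂ) (Matrix n n ℂ) where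
  trace_map' : ∀ X : Matrix n n ℂ, (toLinearMap X).trace = X.trace

/-- `ρ` is the quantum Markov evolution generated by its initial density matrix `ρ 0` and the
sequence of TPCP maps `E`. -/
structure IsQuantumMarkovEvolution {n : Type*} [Fintype n] [DecidableEq n]
    (E : ℕ → TPCPMap n) (ρ : ℕ → Matrix n n ℂ) : Prop where
  initial : IsDensityMatrix (ρ 0)
  step : ∀ t, ρ (t + 1) = (E t).toLinearMap (ρ t)

/-- The observable `σ ^ (-1/2) * ρ * σ ^ (-1/2)`, for a positive definite `σ`. -/
noncomputable def relativeObservable {n : Type*} [Fintype n] [DecidableEq n]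
    (ρ σ : Matrix n n ℂ) : Matrix n n ℂ :=
  (CFC.sqrt σ)⁻¹ * ρ * (CFC.sqrt σ)⁻¹

/-- The Belavkin–Staszewski relative entropy `trace (σ Y log Y)`, `Y = σ ^ (-1/2) ρ σ ^ (-1/2)`.
The trace is real (see `coe_bsRelativeEntropy`), so that its real part is taken. -/
noncomputable def bsRelativeEntropy {n : Type*} [Fintype n] [DecidableEq n]
    (ρ σ : Matrix n n ℂ) : ℝ :=
  (σ * (relativeObservable ρ σ * CFC.log (relativeObservable ρ σ))).trace.re

theorem coe_bsRelativeEntropy {n : Type*} [Fintype n] [DecidableEq n]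
    {ρ σ : Matrix n n ℂ} (hρ : ρ.IsHermitian) (hσ : σ.IsHermitian) :
    (bsRelativeEntropy ρ σ : ℂ) =
      (σ * (relativeObservable ρ σ * CFC.log (relativeObservable ρ σ))).trace := by
  have hs : ((CFC.sqrt σ)⁻¹).IsHermitian :=
    Matrix.IsHermitian.inv (CFC.sqrt_nonneg σ).isSelfAdjoint
  have hY : (relativeObservable ρ σ).IsHermitian := by
    have h := Matrix.isHermitian_mul_mul_conjTranspose (CFC.sqrt σ)⁻¹ hρ
    rwa [hs.eq] at h
  have hL : (CFC.log (relativeObservable ρ σ)).IsHermitian := IsSelfAdjoint.log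
  have hc : Commute (relativeObservable ρ σ) (CFC.log (relativeObservable ρ σ)) := by
    have h := cfc_commute_cfc (fun x : ℝ => x) Real.log (relativeObservable ρ σ)
    rwa [cfc_id' ℝ (relativeObservable ρ σ) hY.isSelfAdjoint] at h
  unfold bsRelativeEntropy
  apply Complex.conj_eq_iff_re.mp
  rw [starRingEnd_apply, ← Matrix.trace_conjTranspose, Matrix.conjTranspose_mul,
    Matrix.conjTranspose_mul, hσ.eq, hY.eq, hL.eq, Matrix.trace_mul_comm, hc.eq]

/-! In an eigenbasis of `Y`, the entropy is `∑ wᵢ xᵢ log xᵢ`, with `xᵢ` the eigenvalues and `wᵢ` the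
spectral weights of `σ`. Mass `tr σ` and mean `tr ρ` are preserved by the map, so comparing
entropies reduces to comparing the Stieltjes transforms `∑ wᵢ / (s + xᵢ)` for `s > 0`. These equal
`tr (σ (sσ + ρ)⁻¹ σ)`, free of square roots, and decrease under the map by the Lieb–Ruskai
inequality `map_mul_inv_mul_map_le` and trace preservation. -/

open Filter Topology in
/-- If two real weightings of finitely many positive points have the same mass and the same mean,
and if their Stieltjes transforms are comparable on the positive half-line, then the sums of
`x * log x` are comparable. -/
theorem sum_mul_log_le_of_sum_div_le {ι κ : Type*} [Fintype ι] [Fintype κ]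
    {w x : ι → ℝ} {v y : κ → ℝ} (hx : ∀ i, 0 < x i) (hy : ∀ i, 0 < y i)
    (hmass : ∑ i, v i = ∑ i, w i) (hmean : ∑ i, v i * y i = ∑ i, w i * x i)
    (h : ∀ s > 0, ∑ i, v i / (s + y i) ≤ ∑ i, w i / (s + x i)) :
    ∑ i, v i * (y i * Real.log (y i)) ≤ ∑ i, w i * (x i * Real.log (x i)) := by
  set G : ℝ → ℝ := fun s ↦ ∑ i, w i * x i * Real.log (s + x i) -
    ∑ i, v i * y i * Real.log (s + y i) with hG
  have hd : ∀ s, 0 ≤ s → HasDerivAt G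
      (∑ i, w i * x i * (1 / (s + x i)) - ∑ i, v i * y i * (1 / (s + y i))) s := by
    intro s hs
    refine HasDerivAt.sub (HasDerivAt.fun_sum fun i _ ↦ ?_) (HasDerivAt.fun_sum fun i _ ↦ ?_)
    · exact (((hasDerivAt_id s).add_const (x i)).log (by have := hx i; simp; positivity)).const_mul _
    · exact (((hasDerivAt_id s).add_const (y i)).log (by have := hy i; simp; positivity)).const_mul _
  have hanti : AntitoneOn G (Set.Ici 0) := by
    refine antitoneOn_of_deriv_nonpos (convex_Ici 0)
      (fun s hs ↦ (hd s hs).continuousAt.continuousWithinAt)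
      (fun s hs ↦ (hd s (interior_subset hs)).differentiableAt.differentiableWithinAt) ?_
    intro s hs
    rw [interior_Ici, Set.mem_Ioi] at hs
    rw [(hd s hs.le).deriv]
    -- Since the masses agree, this makes `G'` equal to `-s` times the difference of the Stieltjes
    -- transforms.
    have e₁ : ∀ i, w i * x i * (1 / (s + x i)) = w i - s * (w i / (s + x i)) := by
      intro i
      have : s + x i ≠ 0 := (add_pos hs (hx i)).ne'
      field_simp
      ring
    have e₂ : ∀ i, v i * y i * (1 / (s + y i)) = v i - s * (v i / (s + y i)) := by
      intro i
      have : s + y i ≠ 0 := (add_pos hs (hy i)).ne'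
      field_simp
      ring
    simp only [e₁, e₂, Finset.sum_sub_distrib, ← Finset.mul_sum, hmass]
    nlinarith [mul_le_mul_of_nonneg_left (h s hs) hs.le]
  have hlim : Tendsto G atTop (𝓝 0) := by
    -- Equal means allow `log s` to be subtracted from every logarithm.
    have e : G = fun s ↦ ∑ i, w i * x i * (Real.log (s + x i) - Real.log s) -
        ∑ i, v i * y i * (Real.log (s + y i) - Real.log s) := by
      funext s
      simp only [hG, mul_sub, Finset.sum_sub_distrib, ← Finset.sum_mul, hmean]
      ring
    have t : Tendsto (fun s ↦ ∑ i, w i * x i * (Real.log (s + x i) - Real.log s) -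
        ∑ i, v i * y i * (Real.log (s + y i) - Real.log s)) atTop
        (𝓝 (∑ i, w i * x i * 0 - ∑ i, v i * y i * 0)) :=
      (tendsto_finsetSum _ fun i _ ↦ (Real.tendsto_log_comp_add_sub_log (x i)).const_mul _).sub
        (tendsto_finsetSum _ fun i _ ↦ (Real.tendsto_log_comp_add_sub_log (y i)).const_mul _)
    simpa [e] using t
  have h0 : 0 ≤ G 0 := by
    refine le_of_tendsto hlim ?_
    filter_upwards [eventually_ge_atTop 0] with s hs
    exact hanti Set.self_mem_Ici hs hs
  simp only [hG, zero_add, mul_assoc] at h0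
  linarith

theorem CStarMatrix.diag_nonneg {A m : Type*} [NonUnitalCStarAlgebra A] [PartialOrder A]
    [StarOrderedRing A] [Fintype m] {M : CStarMatrix m m A} (hM : 0 ≤ M) (i : m) : 0 ≤ M i i := by
  rw [StarOrderedRing.nonneg_iff] at hM
  induction hM using AddSubmonoid.closure_induction with
  | mem x hx =>
    obtain ⟨y, rfl⟩ := hx
    beta_reduce
    rw [CStarMatrix.mul_apply]
    exact Finset.sum_nonneg fun j _ ↦ star_mul_self_nonneg (y j i)
  | zero => exact le_rfl
  | add x y _ _ hx hy => exact add_nonneg hx hy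

namespace Matrix

variable {n : Type*} [Fintype n] [DecidableEq n]

/-- The spectral weights of `Y` with respect to `σ`: the real parts of the diagonal entries of `σ`
in an eigenbasis of `Y`. -/
noncomputable def IsHermitian.spectralWeight {Y : Matrix n n ℂ} (hY : Y.IsHermitian)
    (σ : Matrix n n ℂ) (i : n) : ℝ :=
  (((hY.eigenvectorUnitary : Matrix n n ℂ)ᴴ * σ * (hY.eigenvectorUnitary : Matrix n n ℂ)) i i).re

theorem IsHermitian.re_trace_mul_cfc {Y : Matrix n n ℂ} (hY : Y.IsHermitian)
    (σ : Matrix n n ℂ) (f : ℝ → ℝ) :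
    (σ * cfc f Y).trace.re = ∑ i, hY.spectralWeight σ i * f (hY.eigenvalues i) := by
  have e : (σ * cfc f Y).trace = (((hY.eigenvectorUnitary : Matrix n n ℂ)ᴴ * σ *
      (hY.eigenvectorUnitary : Matrix n n ℂ)) *
      diagonal (RCLike.ofReal ∘ f ∘ hY.eigenvalues)).trace := by
    rw [hY.cfc_eq, IsHermitian.cfc, Unitary.conjStarAlgAut_apply, ← star_eq_conjTranspose,
      ← mul_assoc, trace_mul_comm]
    simp only [mul_assoc]
  rw [e, trace, Complex.re_sum]
  refine Finset.sum_congr rfl fun i _ ↦ ?_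
  rw [diag_apply, mul_diagonal, IsHermitian.spectralWeight]
  simp

/-- A completely positive map satisfies the Lieb–Ruskai form of the Schwarz inequality. -/
theorem map_mul_inv_mul_map_le (E : CompletelyPositiveMap (Matrix n n ℂ) (Matrix n n ℂ))
    {A B : Matrix n n ℂ} (hA : A.PosDef) (hEA : (E A).PosDef) (hB : B.IsHermitian)
    (hEB : (E B).IsHermitian) : E B * (E A)⁻¹ * E B ≤ E (B * A⁻¹ * B) := by
  set S := CFC.sqrt A
  have hS : Sᴴ = S := (CFC.sqrt_nonneg A).isSelfAdjoint
  have hSS : S * S = A := CFC.sqrt_mul_sqrt_self A hA.posSemidef.nonneg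
  have hSu : IsUnit S.det := by
    have := (isUnit_iff_isUnit_det _).1 hA.isUnit
    rw [← hSS, det_mul] at this
    exact isUnit_of_mul_isUnit_left this
  have hSi : (S⁻¹)ᴴ = S⁻¹ := by rw [conjTranspose_nonsing_inv, hS]
  -- Chosen so that `star R * R` is the block matrix with rows `A, B` and `B, B * A⁻¹ * B`.
  let R : CStarMatrix (Fin 2) (Fin 2) (Matrix n n ℂ) :=
    CStarMatrix.ofMatrix !![S, S⁻¹ * B; 0, 0]
  have h := E.map_cstarMatrix_nonneg (star R * R) (star_mul_self_nonneg R)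
  have h00 : (star R * R) 0 0 = A := by
    simp [R, CStarMatrix.mul_apply, CStarMatrix.star_apply, star_eq_conjTranspose, hS, hSS]
  have h01 : (star R * R) 0 1 = B := by
    simp [R, CStarMatrix.mul_apply, CStarMatrix.star_apply, star_eq_conjTranspose, hS,
      mul_nonsing_inv_cancel_left _ _ hSu]
  have h10 : (star R * R) 1 0 = B := by
    simp [R, CStarMatrix.mul_apply, CStarMatrix.star_apply, star_eq_conjTranspose, hSi, hB.eq,
      nonsing_inv_mul_cancel_right _ _ hSu]
  have h11 : (star R * R) 1 1 = B * A⁻¹ * B := by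
    simp [R, CStarMatrix.mul_apply, CStarMatrix.star_apply, star_eq_conjTranspose, hSi, hB.eq,
      ← hSS, mul_inv_rev, mul_assoc]
  -- The first column is the Schur complement vector: conjugation by `V` leaves the complement of `E
  -- A` in the top left corner.
  let V : CStarMatrix (Fin 2) (Fin 2) (Matrix n n ℂ) :=
    CStarMatrix.ofMatrix !![-((E A)⁻¹ * E B), 0; 1, 0]
  have hnn := CStarMatrix.diag_nonneg (star_left_conjugate_nonneg h V) 0
  have hEAu := (isUnit_iff_isUnit_det _).1 hEA.isUnit
  have key : (star V * (star R * R).map E * V) 0 0 =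
      E (B * A⁻¹ * B) - E B * (E A)⁻¹ * E B := by
    have hAi : ((E A)⁻¹)ᴴ = (E A)⁻¹ := hEA.isHermitian.inv
    generalize star R * R = M at h00 h01 h10 h11 ⊢
    simp only [CStarMatrix.mul_apply, Fin.sum_univ_two, CStarMatrix.map_apply, h00, h01, h10, h11]
    simp [V, CStarMatrix.star_apply, star_eq_conjTranspose, hAi, hEB.eq,
      nonsing_inv_mul_cancel_right _ _ hEAu, mul_assoc]
    abel
  rw [key] at hnn
  exact sub_nonneg.1 hnn

end Matrix

/-! ### Mass, mean and Stieltjes transform of the relative observable -/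

section RelativeObservable

open Matrix

variable {n : Type*} [Fintype n] [DecidableEq n] {ρ σ : Matrix n n ℂ}

theorem isHermitian_sqrt (σ : Matrix n n ℂ) : (CFC.sqrt σ).IsHermitian :=
  (CFC.sqrt_nonneg σ).isSelfAdjoint

theorem Matrix.PosDef.isUnit_sqrt (hσ : σ.PosDef) : IsUnit (CFC.sqrt σ) := by
  have := hσ.isUnit
  rw [← CFC.sqrt_mul_sqrt_self σ hσ.posSemidef.nonneg, isUnit_iff_isUnit_det, det_mul] at this
  exact (isUnit_iff_isUnit_det _).2 (isUnit_of_mul_isUnit_left this)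

theorem posDef_relativeObservable (hρ : ρ.PosDef) (hσ : σ.PosDef) :
    (relativeObservable ρ σ).PosDef := by
  have hu : IsUnit (CFC.sqrt σ)⁻¹ := (isUnit_nonsing_inv_iff).2 hσ.isUnit_sqrt
  have := (IsUnit.posDef_star_right_conjugate_iff hu).2 hρ
  rwa [star_eq_conjTranspose, (isHermitian_sqrt σ).inv.eq] at this

theorem trace_mul_relativeObservable (hσ : σ.PosDef) :
    (σ * relativeObservable ρ σ).trace = ρ.trace := by
  have hu := (isUnit_iff_isUnit_det _).1 hσ.isUnit_sqrt
  set S := CFC.sqrt σ with hS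
  have hSS : S * S = σ := CFC.sqrt_mul_sqrt_self σ hσ.posSemidef.nonneg
  rw [relativeObservable, ← hS, ← hSS, trace_mul_comm]
  simp only [mul_assoc, nonsing_inv_mul_cancel_left _ _ hu]
  rw [trace_mul_comm]
  rw [mul_assoc, mul_nonsing_inv _ hu, mul_one]

/-- With `S = √σ`, `s + Y = S⁻¹ (sσ + ρ) S⁻¹`; inverting and cycling the trace removes `S`. -/
theorem trace_mul_inv_relativeObservable_add (hσ : σ.PosDef) (s : ℝ) :
    (σ * (s • 1 + relativeObservable ρ σ)⁻¹).trace = (σ * (s • σ + ρ)⁻¹ * σ).trace := by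
  have hu := (isUnit_iff_isUnit_det _).1 hσ.isUnit_sqrt
  set S := CFC.sqrt σ with hS
  have hSS : S * S = σ := CFC.sqrt_mul_sqrt_self σ hσ.posSemidef.nonneg
  have e : s • 1 + relativeObservable ρ σ = S⁻¹ * (s • σ + ρ) * S⁻¹ := by
    rw [relativeObservable, ← hS, mul_add, add_mul, ← hSS]
    simp [mul_assoc, mul_nonsing_inv _ hu, nonsing_inv_mul _ hu]
  rw [e, Matrix.mul_inv_rev, Matrix.mul_inv_rev, nonsing_inv_nonsing_inv _ hu, ← hSS,
    ← mul_assoc, ← mul_assoc, trace_mul_comm, trace_mul_comm (S * S * _)]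
  simp only [mul_assoc]

theorem bsRelativeEntropy_eq_sum (hY : (relativeObservable ρ σ).PosDef) :
    bsRelativeEntropy ρ σ = ∑ i, hY.isHermitian.spectralWeight σ i *
      (hY.isHermitian.eigenvalues i * Real.log (hY.isHermitian.eigenvalues i)) := by
  rw [← hY.isHermitian.re_trace_mul_cfc σ (fun x ↦ x * Real.log x), bsRelativeEntropy]
  have hc : ∀ f : ℝ → ℝ, ContinuousOn f (spectrum ℝ (relativeObservable ρ σ)) :=
    fun f ↦ (Matrix.finite_real_spectrum).continuousOn f
  rw [cfc_mul (fun x : ℝ ↦ x) Real.log _ (hc _) (hc _),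
    cfc_id' ℝ (relativeObservable ρ σ) hY.isHermitian.isSelfAdjoint, CFC.log]

theorem sum_spectralWeight (hY : (relativeObservable ρ σ).IsHermitian) :
    ∑ i, hY.spectralWeight σ i = σ.trace.re := by
  have := hY.re_trace_mul_cfc σ (fun _ ↦ 1)
  rw [cfc_const_one ℝ (relativeObservable ρ σ) hY.isSelfAdjoint] at this
  simpa using this.symm

theorem sum_spectralWeight_mul (hσ : σ.PosDef) (hY : (relativeObservable ρ σ).IsHermitian) :
    ∑ i, hY.spectralWeight σ i * hY.eigenvalues i = ρ.trace.re := by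
  have := hY.re_trace_mul_cfc σ (fun x ↦ x)
  rw [cfc_id' ℝ (relativeObservable ρ σ) hY.isSelfAdjoint, trace_mul_relativeObservable hσ] at this
  exact this.symm

theorem sum_spectralWeight_div (hσ : σ.PosDef) (hY : (relativeObservable ρ σ).PosDef) {s : ℝ}
    (hs : 0 < s) :
    ∑ i, hY.isHermitian.spectralWeight σ i / (s + hY.isHermitian.eigenvalues i) =
      (σ * (s • σ + ρ)⁻¹ * σ).trace.re := by
  have hsa : IsSelfAdjoint (relativeObservable ρ σ) := hY.isHermitian.isSelfAdjoint
  have hc : ∀ f : ℝ → ℝ, ContinuousOn f (spectrum ℝ (relativeObservable ρ σ)) :=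
    fun f ↦ (Matrix.finite_real_spectrum).continuousOn f
  have e : (s • 1 + relativeObservable ρ σ)⁻¹ =
      cfc (fun x : ℝ ↦ (s + x)⁻¹) (relativeObservable ρ σ) := by
    have h1 : s • 1 + relativeObservable ρ σ =
        cfc (fun x : ℝ ↦ s + x) (relativeObservable ρ σ) := by
      rw [cfc_const_add s (fun x : ℝ ↦ x) _ (hc _), cfc_id' ℝ (relativeObservable ρ σ) hsa,
        Algebra.algebraMap_eq_smul_one]
    refine inv_eq_right_inv ?_
    rw [h1, ← cfc_mul _ _ _ (hc _) (hc _), ← cfc_const_one ℝ (relativeObservable ρ σ) hsa]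
    refine cfc_congr fun x hx ↦ mul_inv_cancel₀ ?_
    have := hY.isStrictlyPositive.spectrum_pos (𝕜 := ℝ) hx
    positivity
  rw [← trace_mul_inv_relativeObservable_add hσ, e, hY.isHermitian.re_trace_mul_cfc]
  simp only [div_eq_mul_inv]

end RelativeObservable

/-- Data processing: the Belavkin–Staszewski relative entropy of positive definite matrices does not
increase under a TPCP map that keeps them positive definite. -/
theorem bsRelativeEntropy_map_le {n : Type*} [Fintype n] [DecidableEq n] (E : TPCPMap n)
    {ρ σ : Matrix n n ℂ} (hρ : ρ.PosDef) (hσ : σ.PosDef) (hEρ : (E.toLinearMap ρ).PosDef)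
    (hEσ : (E.toLinearMap σ).PosDef) :
    bsRelativeEntropy (E.toLinearMap ρ) (E.toLinearMap σ) ≤ bsRelativeEntropy ρ σ := by
  have hY := posDef_relativeObservable hρ hσ
  have hZ := posDef_relativeObservable hEρ hEσ
  rw [bsRelativeEntropy_eq_sum hY, bsRelativeEntropy_eq_sum hZ]
  refine sum_mul_log_le_of_sum_div_le hY.eigenvalues_pos hZ.eigenvalues_pos ?_ ?_ fun s hs ↦ ?_
  · rw [sum_spectralWeight, sum_spectralWeight, E.trace_map']
  · rw [sum_spectralWeight_mul hEσ, sum_spectralWeight_mul hσ, E.trace_map']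
  · rw [sum_spectralWeight_div hEσ hZ hs, sum_spectralWeight_div hσ hY hs,
      ← E.trace_map' (σ * (s • σ + ρ)⁻¹ * σ)]
    have hlin : E.toLinearMap (s • σ + ρ) = s • E.toLinearMap σ + E.toLinearMap ρ := by
      rw [map_add, LinearMap.map_smul_of_tower]
    -- `A` is linear in the pair `(ρ, σ)`, so `E A` is the same combination of the evolved states.
    have h := Matrix.map_mul_inv_mul_map_le E.toCompletelyPositiveMap
      (A := s • σ + ρ) (B := σ) ((hσ.smul hs).add hρ)
      (by change (E.toLinearMap (s • σ + ρ)).PosDef; rw [hlin]; exact (hEσ.smul hs).add hEρ)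
      hσ.isHermitian hEσ.isHermitian
    change E.toLinearMap σ * (E.toLinearMap (s • σ + ρ))⁻¹ * E.toLinearMap σ ≤
      E.toLinearMap (σ * (s • σ + ρ)⁻¹ * σ) at h
    rw [hlin] at h
    have ht := (Matrix.le_iff.1 h).trace_nonneg
    rw [Matrix.trace_sub] at ht
    have := (Complex.le_def.1 ht).1
    simpa using this

theorem IsQuantumMarkovEvolution.posSemidef {n : Type*} [Fintype n] [DecidableEq n]
    {E : ℕ → TPCPMap n} {ρ : ℕ → Matrix n n ℂ} (hρ : IsQuantumMarkovEvolution E ρ) (t : ℕ) :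
    (ρ t).PosSemidef := by
  induction t with
  | zero => exact hρ.initial.posSemidef
  | succ t ih =>
    rw [hρ.step t]
    exact Matrix.nonneg_iff_posSemidef.1
      (map_nonneg (E t).toCompletelyPositiveMap ih.nonneg)

theorem mainTheorem2 {n : Type*} [Fintype n] [DecidableEq n]
    (E : ℕ → TPCPMap n) (ρ σ : ℕ → Matrix n n ℂ)
    (hρ : IsQuantumMarkovEvolution E ρ) (hσ : IsQuantumMarkovEvolution E σ)
    (hρinv : ∀ t, IsUnit (ρ t)) (hσinv : ∀ t, IsUnit (σ t)) :
    ∀ t, bsRelativeEntropy (ρ (t + 1)) (σ (t + 1)) ≤ bsRelativeEntropy (ρ t) (σ t) := by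
  intro t
  have hpρ : ∀ t, (ρ t).PosDef := fun t ↦ (hρ.posSemidef t).posDef_iff_isUnit.2 (hρinv t)
  have hpσ : ∀ t, (σ t).PosDef := fun t ↦ (hσ.posSemidef t).posDef_iff_isUnit.2 (hσinv t)
  have hρ' := hpρ (t + 1)
  have hσ' := hpσ (t + 1)
  rw [hρ.step t] at hρ' ⊢
  rw [hσ.step t] at hσ' ⊢
  exact bsRelativeEntropy_map_le (E t) (hpρ t) (hpσ t) hρ' hσ'
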